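/- **Setting.** Let $d,L\ge 1$ and let $x_0,\dots,x_{L-1}$ be random vectors in $\mathbb R^d$ (on one probability space, with no independence assumed), each with mean zero, identity covariance and $\|x_t\|_2\le B$ almost surely. Write $X=(x_0,\dots,x_{L-1})$ and put $x_t=0$ for all other $t\in\mathbb Z$ (zero padding). Let $\rho_i\in\mathbb R^{d\times d}$ $(i\ge 0)$ be a kernel with $\|\rho_1\|_2\ge\|\rho_2\|_2\ge\cdots$ (spectral norms). The target is $$\mathrm H_t(X)=\sum_{i=0}^{\infty}\rho_i x_{t-i},\qquad 0\le t<L .$$ **Hypothesis class.** Let $M$ groups of attention heads be given, where group $m\in\{1,\dots,M\}$ has $H_m\ge1$ heads of dimension $d_m\ge 1$, and let $D=\sum_{m=1}^M H_m d_m$ with $d\le D$. Let $\mathcal T^D$ be the set of single-layer Transformers with model dimension $D$ and these heads. Such a $T$ embeds $x_t^{(0)}=W_Ex_t+b_E\in\mathbb R^D$ for all $t\in\mathbb Z$. A head of dimension $k$ has $W_Q,W_K,W_V\in\mathbb R^{k\times D}$ and a slope $p>0$, and outputs at $t$ $$\sum_{s\ge 0}w_{t,s}\,W_Vx^{(0)}_{t-s},\qquad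 w_{t,s}=\frac{e^{\ell_{t,s}}}{\sum_{j\ge 0}e^{\ell_{t,j}}},\qquad \ell_{t,s}=\langle W_Qx^{(0)}_t,W_Kx^{(0)}_{t-s}\rangle-p\,s$$ (causal softmax attention with the Alibi relative positional encoding, over the zero-padded past). The outputs of all heads are concatenated to $c_t\in\mathbb R^D$, and $T(X)_t=\mathrm{FFN}(x_t^{(0)}+W_Oc_t)\in\mathbb R^d$, where $W_O\in\mathbb R^{D\times D}$ and $\mathrm{FFN}:\mathbb R^D\to\mathbb R^d$ is a two-layer ReLU network of arbitrary width. Let $\|\mathrm H(X)-T(X)\|_{2,\infty}=\max_{0\le t<L}\|\mathrm H_t(X)-T(X)_t\|_2$ and $\mathcal E_D(X)=\inf_{T\in\mathcal T^D}\|\mathrm H(X)-T(X)\|_{2,\infty}$. **Theorem.** Let $\delta\in(0,1)$ and $$\mathcal B_\delta=\sum_{m=1}^M\|\rho_m\|_2B\left((1+\varepsilon_\delta)\,\mathbb 1_{\{d_m\le d\}}\sqrt{1-\frac{d_m}{d}}+\frac{1.3\,e^{0.02m}}{H_m}\right)+\sum_{k=M+1}^{L}\|\rho_k\|_2B,\qquad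 \varepsilon_\delta=\sqrt{\frac{2\log(2ML/\delta)}{\min_m d_m}},$$ where the first term in the bracket is zero when $d_m>d$. Then there is one $T\in\mathcal T^D$, not depending on the realization of $X$, such that with probability at least $1-\delta$ $$\|\mathrm H(X)-T(X)\|_{2,\infty}\le\mathcal B_\delta .$$ In particular, with probability at least $1-\delta$, $\mathcal E_D(X)\le\mathcal B_\delta$. -/

import Mathlib

open MeasureTheory

noncomputable section

/-- `ℝⁿ` with the Euclidean norm. -/
abbrev Vec (n : ℕ) : Type := EuclideanSpace ℝ (Fin n)

/-- The spectral norm `‖A‖₂` of a square matrix (operator norm for the Euclidean norm). -/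
def specNorm {d : ℕ} (A : Matrix (Fin d) (Fin d) ℝ) : ℝ :=
  ‖Matrix.toEuclideanCLM (n := Fin d) (𝕜 := ℝ) A‖

/-- Zero padding: the sequence of `L` tokens occupies the positions `0, …, L - 1` of `ℤ`,
and the token at every other position is `0`. -/
def zeroPad {d L : ℕ} (X : Fin L → Vec d) (t : ℤ) : Vec d :=
  if h : 0 ≤ t ∧ t < (L : ℤ) then X ⟨t.toNat, by omega⟩ else 0

/-- The linear convolutional target `H_t(X) = ∑_{i ≥ 0} ρ_i x_{t-i}`. Because of the zero padding
the sum has finite support. -/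
def convTarget {d L : ℕ} (ρ : ℕ → Matrix (Fin d) (Fin d) ℝ) (X : Fin L → Vec d) (t : ℤ) : Vec d :=
  ∑' i : ℕ, WithLp.toLp 2 ((ρ i).mulVec (zeroPad X (t - i)).ofLp)

/-- The parameters of one attention head of dimension `k` in a model of dimension `D`: the query,
key and value matrices and the slope `p` of the Alibi relative positional encoding
`φ(z) = -p z` for `z ≥ 0`, `φ(z) = -∞` for `z < 0`. -/
structure Head (D k : ℕ) where
  WQ : Matrix (Fin k) (Fin D) ℝ
  WK : Matrix (Fin k) (Fin D) ℝ
  WV : Matrix (Fin k) (Fin D) ℝ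
  slope : ℝ
  slope_pos : 0 < slope

namespace Head

variable {D k : ℕ}

/-- The attention logit of the query at position `t` and the key at position `t - s`, `s ≥ 0`
(positions after `t` carry the logit `-∞`, that is, the weight `0`). -/
def logit (A : Head D k) (Z : ℤ → Fin D → ℝ) (t : ℤ) (s : ℕ) : ℝ :=
  A.WQ.mulVec (Z t) ⬝ᵥ A.WK.mulVec (Z (t - s)) - A.slope * s

/-- The softmax weight which position `t` puts on position `t - s`. -/
def weight (A : Head D k) (Z : ℤ → Fin D → ℝ) (t : ℤ) (s : ℕ) : ℝ :=
  Real.exp (A.logit Z t s) / ∑' j : ℕ, Real.exp (A.logit Z t j)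

/-- The output of the head at position `t`. -/
def attn (A : Head D k) (Z : ℤ → Fin D → ℝ) (t : ℤ) : Fin k → ℝ :=
  ∑' s : ℕ, A.weight Z t s • A.WV.mulVec (Z (t - s))

/-- The softmax normalization is a convergent sum for every input that is constant before
some position, in particular for every embedded zero-padded sequence. -/
theorem summable_exp_logit (A : Head D k) (Z : ℤ → Fin D → ℝ) (t : ℤ) (c : Fin D → ℝ)
    (hc : ∀ r : ℤ, r < 0 → Z r = c) : Summable fun s : ℕ => Real.exp (A.logit Z t s) := by
  have h1 : Summable fun s : ℕ =>
      Real.exp (A.WQ.mulVec (Z t) ⬝ᵥ A.WK.mulVec c) * Real.exp (-A.slope) ^ s :=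
    (summable_geometric_of_lt_one (Real.exp_pos _).le
      (Real.exp_lt_one_iff.mpr (by linarith [A.slope_pos]))).mul_left _
  refine h1.congr_cofinite ?_
  rw [Nat.cofinite_eq_atTop]
  filter_upwards [Filter.eventually_gt_atTop t.toNat] with s hs
  rw [logit, hc (t - s) (by omega), ← Real.exp_nat_mul, ← Real.exp_add]
  congr 1
  ring

end Head

/-- A token-wise feed forward network `ℝ^D → ℝ^d`: a two-layer ReLU network of any width. -/
structure FFN (D d : ℕ) where
  width : ℕ
  W₁ : Matrix (Fin width) (Fin D) ℝ
  b₁ : Fin width → ℝ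
  W₂ : Matrix (Fin d) (Fin width) ℝ
  b₂ : Fin d → ℝ

/-- The function computed by a feed forward network. -/
def FFN.eval {D d : ℕ} (F : FFN D d) (z : Fin D → ℝ) : Vec d :=
  WithLp.toLp 2 (F.W₂.mulVec (fun i => max ((F.W₁.mulVec z + F.b₁) i) 0) + F.b₂)

/-- The parameters of a single-layer Transformer with token dimension `d` and model dimension `D`
whose heads form `M` groups, group `m` having `H m` heads of dimension `dh m`. The columns of the
output matrix `WO` are indexed by the coordinates of the concatenated outputs of all heads;
there are `∑ m, H m * dh m` of them, so `WO` is a `D × D` matrix when this sum is `D`. -/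
structure Transformer (d D M : ℕ) (H dh : Fin M → ℕ) where
  WE : Matrix (Fin D) (Fin d) ℝ
  bE : Fin D → ℝ
  head : (m : Fin M) → Fin (H m) → Head D (dh m)
  WO : Matrix (Fin D) ((m : Fin M) × Fin (H m) × Fin (dh m)) ℝ
  ffn : FFN D d

namespace Transformer

variable {d D M L : ℕ} {H dh : Fin M → ℕ}

/-- The embedded sequence `x_t⁽⁰⁾ = W_E x_t + b_E`. -/
def embed (T : Transformer d D M H dh) (X : Fin L → Vec d) (t : ℤ) : Fin D → ℝ :=
  T.WE.mulVec (zeroPad X t).ofLp + T.bE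

/-- Multi-head self-attention: `W_O` applied to the concatenation of the outputs of all heads. -/
def mhsa (T : Transformer d D M H dh) (Z : ℤ → Fin D → ℝ) (t : ℤ) : Fin D → ℝ :=
  T.WO.mulVec fun q => (T.head q.1 q.2.1).attn Z t q.2.2

/-- The output at position `t`: embedding, multi-head attention with residual connection,
feed forward network. -/
def eval (T : Transformer d D M H dh) (X : Fin L → Vec d) (t : ℤ) : Vec d :=
  T.ffn.eval (T.embed X t + T.mhsa (T.embed X) t)

end Transformer

/-- The error `‖H(X) - T(X)‖_{2,∞}`: the largest Euclidean error over the `L` positions. -/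
def seqError {d D M L : ℕ} {H dh : Fin M → ℕ} (ρ : ℕ → Matrix (Fin d) (Fin d) ℝ)
    (T : Transformer d D M H dh) (X : Fin L → Vec d) : ℝ :=
  ⨆ t : Fin L, ‖convTarget ρ X (t : ℕ) - T.eval X (t : ℕ)‖

/-- The approximation error `𝓔_D(X)`: the infimum of `‖H(X) - T(X)‖_{2,∞}` over all
single-layer Transformers `T` with model dimension `D` and the given arrangement of heads. -/
def approxError {d L : ℕ} (D M : ℕ) (H dh : Fin M → ℕ) (ρ : ℕ → Matrix (Fin d) (Fin d) ℝ)
    (X : Fin L → Vec d) : ℝ :=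
  ⨅ T : Transformer d D M H dh, seqError ρ T X

/-- `ε_δ = √(2 log(2 M L / δ) / min_m d_m)`. -/
def epsDelta (M L : ℕ) (dh : Fin M → ℕ) (δ : ℝ) : ℝ :=
  Real.sqrt (2 * Real.log (2 * M * L / δ) / ⨅ m : Fin M, (dh m : ℝ))

/-- The bound on the approximation error. Group number `m + 1` has the index `m : Fin M`. -/
def tradeoffBound {d : ℕ} (M L : ℕ) (H dh : Fin M → ℕ) (ρ : ℕ → Matrix (Fin d) (Fin d) ℝ)
    (B δ : ℝ) : ℝ :=
  (∑ m : Fin M, specNorm (ρ ((m : ℕ) + 1)) * B *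
      ((1 + epsDelta M L dh δ) * (if dh m ≤ d then Real.sqrt (1 - (dh m : ℝ) / (d : ℝ)) else 0)
        + 1.3 * Real.exp (0.02 * (((m : ℕ) : ℝ) + 1)) / (H m : ℝ)))
    + ∑ k ∈ Finset.Icc (M + 1) L, specNorm (ρ k) * B

end

/-! One Transformer satisfies the bound for every sequence with all `‖x_t‖ ≤ B`, so probability
enters only through an almost sure event. With zero query and key matrices, a head averages the past
with weights `(1 - r) r ^ s`. A head of dimension `k` gives at most `min k d` token coordinates the
rate `r`, so with `S = ∑ H_m min(d_m, d)` each coordinate can receive `n = ⌊S / d⌋` rates from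
distinct heads (`exists_balanced_slots`). By Vandermonde, `n` distinct rates interpolate the kernel
at lags `1, …, n`; letting all rates shrink together makes the later lags negligible
(`eventually_exists_exponential_sum`). Lag `0` goes through the residual connection. The error is
thus the tail of `‖ρ_k‖ B` after lag `n`, plus an arbitrarily small term
(`Transformer.exists_norm_sub_le`). It remains to pay for that tail. Since `y ≤ √y` on `[0, 1]`,
group `m` contributes weight at least `1 - min(d_m, d) / d + 1.3 / H_m`. Because the norms decrease,
summation by parts reduces the claim to partial sums of these weights, where only the rounding in
`n` has to be absorbed (`sum_tail_le_sum_weights`). The constant `1.3 > 1` leaves slack for the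
small term. -/

/-! ### Balanced distribution of head coordinates -/

/-- Slots `(h, a)`, `a < k h ≤ d`, can be assigned to `d` coordinates so that every coordinate
receives `n` slots with pairwise distinct first components, as soon as there are `n * d` slots. -/
theorem exists_balanced_slots {ι : Type*} [Fintype ι] (k : ι → ℕ) (d n : ℕ)
    (hk : ∀ h, k h ≤ d) (hn : n * d ≤ ∑ h, k h) :
    ∃ e : Fin d → Fin n → (h : ι) × Fin (k h),
      (∀ i, Function.Injective fun j => (e i j).1) ∧
      ∀ i i' j j', e i j = e i' j' → i = i' := by
  classical
  let φ := Fintype.equivFin ι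
  let k' : Fin (Fintype.card ι) → ℕ := fun p => k (φ.symm p)
  have hsum : ∑ p, k' p = ∑ h, k h := Equiv.sum_comp φ.symm k
  have hlt (i : Fin d) (j : Fin n) : (i : ℕ) + j * d < ∑ p, k' p := by
    rw [hsum]
    refine lt_of_lt_of_le ?_ hn
    have h1 : (j : ℕ) + 1 ≤ n := j.2
    have h2 := Nat.mul_le_mul_right d h1
    have := i.2
    rw [add_mul] at h2
    omega
  -- Slots are numbered head after head, and coordinate `i` takes the numbers congruent to `i` mod
  -- `d`. Two of these differ by at least `d`, while a head occupies at most `d` consecutive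
  -- numbers, so they lie in different heads.
  let slot (i : Fin d) (j : Fin n) : (p : Fin (Fintype.card ι)) × Fin (k' p) :=
    finSigmaFinEquiv.symm ⟨i + j * d, hlt i j⟩
  have hslot (i : Fin d) (j : Fin n) :
      (finSigmaFinEquiv (slot i j) : ℕ) = i + j * d := by simp [slot]
  have hinj (u w : (p : Fin (Fintype.card ι)) × Fin (k' p))
      (h : (⟨φ.symm u.1, u.2⟩ : (h : ι) × Fin (k h)) = ⟨φ.symm w.1, w.2⟩) : u = w := by
    obtain ⟨p, a⟩ := u
    obtain ⟨p', a'⟩ := w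
    obtain ⟨h1, h2⟩ := Sigma.mk.inj h
    obtain rfl : p = p' := φ.symm.injective h1
    exact congrArg _ (eq_of_heq h2)
  refine ⟨fun i j => ⟨φ.symm (slot i j).1, (slot i j).2⟩, ?_, ?_⟩
  · intro i j j' h
    have h1 : (slot i j).1 = (slot i j').1 := φ.symm.injective h
    have e1 := hslot i j
    have e2 := hslot i j'
    generalize slot i j = u at *
    generalize slot i j' = w at *
    obtain ⟨p, a⟩ := u
    obtain ⟨p', a'⟩ := w
    obtain rfl : p = p' := h1
    rw [finSigmaFinEquiv_apply] at e1 e2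
    have ha : (a : ℕ) < d := lt_of_lt_of_le a.2 (hk _)
    have ha' : (a' : ℕ) < d := lt_of_lt_of_le a'.2 (hk _)
    simp only at e1 e2
    ext
    by_contra hne
    rcases Nat.lt_or_gt_of_ne hne with hl | hl
    · have := Nat.mul_le_mul_right d (Nat.succ_le_of_lt hl)
      rw [Nat.succ_mul] at this
      omega
    · have := Nat.mul_le_mul_right d (Nat.succ_le_of_lt hl)
      rw [Nat.succ_mul] at this
      omega
  · intro i i' j j' h
    have h1 : slot i j = slot i' j' := hinj _ _ h
    have h2 : (i : ℕ) + j * d = i' + j' * d := by rw [← hslot, ← hslot, h1]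
    have h3 := congrArg (· % d) h2
    simp only [Nat.add_mul_mod_self_right, Nat.mod_eq_of_lt i.2, Nat.mod_eq_of_lt i'.2] at h3
    exact Fin.ext h3

/-! ### Interpolation by exponential sums, and invertible perturbations -/

/-- With `n` exponentials `(τ a_j)^s`, `τ → 0`, one can prescribe the values at the lags
`s = 1, …, n` and make the values at the later lags arbitrarily small. -/
theorem eventually_exists_exponential_sum {n : ℕ} (a : Fin n → ℝ) (ha : Function.Injective a)
    (ha0 : ∀ j, a j ≠ 0) (v : ℕ → ℝ) (N : ℕ) (η : ℝ) (hη : 0 < η) :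
    ∀ᶠ τ in nhdsWithin (0 : ℝ) (Set.Ioi 0), ∃ g : Fin n → ℝ,
      (∀ s < n, ∑ j, g j * (τ * a j) ^ (s + 1) = v s) ∧
      ∀ s < N, n ≤ s → |∑ j, g j * (τ * a j) ^ (s + 1)| ≤ η := by
  let A : Matrix (Fin n) (Fin n) ℝ := (Matrix.vandermonde a).transpose * Matrix.diagonal a
  have hdet : IsUnit A.det := by
    rw [isUnit_iff_ne_zero, Matrix.det_mul, Matrix.det_transpose, Matrix.det_diagonal]
    exact mul_ne_zero (Matrix.det_vandermonde_ne_zero_iff.mpr ha)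
      (Finset.prod_ne_zero_iff.mpr fun j _ => ha0 j)
  have hA (s l : Fin n) : ∑ j, a j ^ ((s : ℕ) + 1) * A⁻¹ j l = if s = l then 1 else 0 := by
    have h := congrFun (congrFun (Matrix.mul_nonsing_inv A hdet) s) l
    rw [Matrix.mul_apply, Matrix.one_apply] at h
    rw [← h]
    refine Finset.sum_congr rfl fun j _ => ?_
    simp [A, Matrix.mul_diagonal, Matrix.vandermonde_apply, pow_succ]
  let c (s : ℕ) (l : Fin n) : ℝ := ∑ j, a j ^ (s + 1) * A⁻¹ j l
  -- This solves the system at lags `1, …, n`, whose matrix is `diag(τ ^ (l + 1)) * A`. The value at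
  -- lag `s + 1` becomes `∑ c s l * τ ^ (s - l) * v l`: for `s < n` the matrix `c` is the identity,
  -- and for `s ≥ n` all exponents are positive.
  let g (τ : ℝ) (j : Fin n) : ℝ := ∑ l : Fin n, A⁻¹ j l * ((τ ^ ((l : ℕ) + 1))⁻¹ * v l)
  have hg (τ : ℝ) (s : ℕ) : ∑ j, g τ j * (τ * a j) ^ (s + 1) =
      ∑ l : Fin n, c s l * (τ ^ (s + 1) * (τ ^ ((l : ℕ) + 1))⁻¹ * v l) := by
    simp only [g, c, Finset.sum_mul]
    rw [Finset.sum_comm]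
    refine Finset.sum_congr rfl fun l _ => Finset.sum_congr rfl fun j _ => ?_
    rw [mul_pow]
    ring
  have hlim (s : ℕ) (hs : n ≤ s) : ∀ᶠ τ in nhdsWithin (0 : ℝ) (Set.Ioi 0),
      |∑ j, g τ j * (τ * a j) ^ (s + 1)| ≤ η := by
    have hcont : Continuous fun τ : ℝ => |∑ l : Fin n, c s l * (τ ^ (s - l) * v l)| := by
      fun_prop
    have h0 : |∑ l : Fin n, c s l * ((0 : ℝ) ^ (s - l) * v l)| < η := by
      rw [Finset.sum_eq_zero, abs_zero]
      · exact hη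
      · intro l _
        have := l.2
        rw [zero_pow (by omega)]
        ring
    have h1 := hcont.continuousAt.eventually_lt (continuousAt_const (y := η)) h0
    filter_upwards [nhdsWithin_le_nhds h1, self_mem_nhdsWithin] with τ hτ hpos
    rw [hg]
    refine le_trans (le_of_eq ?_) hτ.le
    congr 1
    refine Finset.sum_congr rfl fun l _ => ?_
    have hl := l.2
    have hτ0 : τ ≠ 0 := ne_of_gt hpos
    have : s + 1 = (s - l) + (l + 1) := by omega
    rw [this, pow_add, mul_assoc (τ ^ (s - (l : ℕ))), mul_inv_cancel₀ (pow_ne_zero _ hτ0), mul_one]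
  have hall : ∀ᶠ τ in nhdsWithin (0 : ℝ) (Set.Ioi 0), ∀ s ∈ Finset.range N, n ≤ s →
      |∑ j, g τ j * (τ * a j) ^ (s + 1)| ≤ η := by
    rw [Filter.eventually_all_finset]
    intro s _
    by_cases h : n ≤ s
    · filter_upwards [hlim s h] with τ hτ _ using hτ
    · exact Filter.Eventually.of_forall fun τ h' => absurd h' h
  filter_upwards [hall, self_mem_nhdsWithin] with τ hτ hpos
  have hτ0 : τ ≠ 0 := ne_of_gt hpos
  refine ⟨g τ, fun s hs => ?_, fun s hs => hτ s (Finset.mem_range.mpr hs)⟩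
  rw [hg, Finset.sum_eq_single ⟨s, hs⟩]
  · have := hA ⟨s, hs⟩ ⟨s, hs⟩
    simp only [if_true] at this
    simp only [c, this, one_mul]
    rw [mul_inv_cancel₀ (pow_ne_zero _ hτ0), one_mul]
  · intro l _ hl
    have := hA ⟨s, hs⟩ l
    rw [if_neg (Ne.symm hl)] at this
    simp only [c, this, zero_mul]
  · simp

/-- A square matrix becomes invertible after adding a small multiple of the identity. -/
theorem exists_small_isUnit_add_smul_one {d : ℕ} (C : Matrix (Fin d) (Fin d) ℝ) {η : ℝ}
    (hη : 0 < η) : ∃ ε : ℝ, 0 < ε ∧ ε ≤ η ∧ IsUnit (C + ε • (1 : Matrix (Fin d) (Fin d) ℝ)).det := by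
  have hinf : (Set.Ioo (0 : ℝ) η).Infinite := Set.Ioo_infinite hη
  -- `det (C + ε I)` is the characteristic polynomial of `-C` at `ε`, so only finitely many `ε`
  -- fail.
  have hne : (-C).charpoly ≠ 0 := (Matrix.charpoly_monic _).ne_zero
  obtain ⟨ε, hε, hroot⟩ := hinf.exists_notMem_finset (-C).charpoly.roots.toFinset
  refine ⟨ε, hε.1, hε.2.le, ?_⟩
  rw [Multiset.mem_toFinset, Polynomial.mem_roots hne, Polynomial.IsRoot, Matrix.eval_charpoly]
    at hroot
  rw [isUnit_iff_ne_zero]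
  convert hroot using 2
  rw [sub_neg_eq_add, add_comm, Matrix.scalar_apply, Matrix.smul_one_eq_diagonal]

/-! ### Rank count against the weights of the bound -/

/-- Summation by parts: nonnegative partial sums against a nonnegative nonincreasing sequence. -/
theorem sum_mul_nonneg_of_partial_sums_nonneg (c f : ℕ → ℝ) (hf : Antitone f) (hf0 : ∀ m, 0 ≤ f m)
    (M : ℕ) (hc : ∀ j ≤ M, 0 ≤ ∑ m ∈ Finset.range j, c m) :
    0 ≤ ∑ m ∈ Finset.range M, c m * f m := by
  have h : ∀ j ≤ M, (∑ m ∈ Finset.range j, c m) * f j ≤ ∑ m ∈ Finset.range j, c m * f m := by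
    intro j
    induction j with
    | zero => simp
    | succ j ih =>
      intro hj
      have h1 := ih (by omega)
      have h2 := mul_le_mul_of_nonneg_left (hf (Nat.le_succ j)) (hc (j + 1) hj)
      rw [Finset.sum_range_succ (fun m => c m * f m)]
      rw [Nat.succ_eq_add_one] at h2
      refine h2.trans ?_
      rw [Finset.sum_range_succ, add_mul]
      linarith
  exact (mul_nonneg (hc M le_rfl) (hf0 M)).trans (h M le_rfl)

/-- With `n = ⌊S / d⌋` for the total rank `S = ∑ H_m k_m`, the lags after `n` are paid for by the
weights `b_m ≥ 1 - k_m / d + 1.3 / H_m`. -/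
theorem sum_tail_le_sum_weights (H k : ℕ → ℕ) (b f : ℕ → ℝ) (d M : ℕ) (hd : 1 ≤ d)
    (hH : ∀ m, 1 ≤ H m) (hS : d ≤ ∑ m ∈ Finset.range M, H m * k m)
    (hb : ∀ m, 1 - (k m : ℝ) / d + 1.3 / H m ≤ b m) (hk : ∀ m, k m ≤ d)
    (hf : Antitone f) (hf0 : ∀ m, 0 ≤ f m) :
    (∑ m ∈ Finset.Ico ((∑ m ∈ Finset.range M, H m * k m) / d) M, f m) + 0.3 / H 0 * f 0 ≤
      ∑ m ∈ Finset.range M, b m * f m := by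
  set S := ∑ m ∈ Finset.range M, H m * k m with hSdef
  set n := S / d with hn
  have hn1 : 1 ≤ n := (Nat.one_le_div_iff (by omega)).mpr hS
  have hSn : S < (n + 1) * d := by
    rw [hn, mul_comm]; exact Nat.lt_mul_div_succ S (by omega)
  have hM : 0 < M := by
    by_contra h
    have : M = 0 := by omega
    subst this
    simp [hSdef] at hS
    omega
  have hd0 : (0 : ℝ) < d := by exact_mod_cast hd
  have hHpos (m : ℕ) : (0 : ℝ) < H m := by exact_mod_cast hH m
  have hH0 : (1 : ℝ) ≤ H 0 := by exact_mod_cast hH 0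
  have hθ : (0.3 : ℝ) / H 0 ≤ 0.3 := by
    rw [div_le_iff₀ (hHpos 0)]; nlinarith
  have hb' (m : ℕ) : 1.3 / (H m : ℝ) ≤ b m := by
    have h1 : (k m : ℝ) / d ≤ 1 := by
      rw [div_le_one hd0]; exact_mod_cast hk m
    linarith [hb m]
  have hθ' : (0.3 : ℝ) / H 0 + 1 / H 0 = 1.3 / H 0 := by
    rw [← add_div]; norm_num
  have hθ'' : (0 : ℝ) < 1 / H 0 := by have := hHpos 0; positivity
  have hbpos (m : ℕ) : 0 < b m := lt_of_lt_of_le (by have := hHpos m; positivity) (hb' m)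
  let c (m : ℕ) : ℝ := b m - (if n ≤ m then 1 else 0) - (if m = 0 then (0.3 : ℝ) / H 0 else 0)
  have hcount (j : ℕ) : ∑ m ∈ Finset.range j, (if n ≤ m then (1 : ℝ) else 0) = ((j - n : ℕ) : ℝ) := by
    rw [← Finset.sum_filter, Finset.sum_const, nsmul_eq_mul, mul_one]
    congr 1
    rw [← Nat.card_Ico]
    congr 1
    ext m
    simp only [Finset.mem_filter, Finset.mem_range, Finset.mem_Ico]
    omega
  have hzero (j : ℕ) (hj : 0 < j) :
      ∑ m ∈ Finset.range j, (if m = 0 then (0.3 : ℝ) / H 0 else 0) = 0.3 / H 0 := by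
    rw [Finset.sum_ite_eq' (Finset.range j) 0]
    simp [hj]
  have hc : ∀ j ≤ M, 0 ≤ ∑ m ∈ Finset.range j, c m := by
    intro j hj
    rcases Nat.eq_zero_or_pos j with rfl | hj0
    · simp
    simp only [c, Finset.sum_sub_distrib]
    rw [hcount, hzero j hj0]
    -- No lag is charged before `n`, so the first weight alone covers `0.3 / H 0`.
    rcases le_or_gt j n with hjn | hjn
    · rw [Nat.sub_eq_zero_of_le hjn]
      have h1 : b 0 ≤ ∑ m ∈ Finset.range j, b m :=
        Finset.single_le_sum (fun m _ => (hbpos m).le) (Finset.mem_range.mpr hj0)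
      have := hb' 0
      push_cast
      linarith
    have hsub : ((j - n : ℕ) : ℝ) = j - n := by rw [Nat.cast_sub hjn.le]
    rw [hsub]
    have hbsum : (j : ℝ) - ((∑ m ∈ Finset.range j, k m : ℕ) : ℝ) / d +
        ∑ m ∈ Finset.range j, 1.3 / (H m : ℝ) ≤ ∑ m ∈ Finset.range j, b m := by
      refine le_trans (le_of_eq ?_) (Finset.sum_le_sum fun m _ => hb m)
      rw [Finset.sum_add_distrib, Finset.sum_sub_distrib, Nat.cast_sum, Finset.sum_div]
      simp
    have hsingle (m : ℕ) (hm : m < j) :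
        1.3 / (H m : ℝ) ≤ ∑ m ∈ Finset.range j, 1.3 / (H m : ℝ) :=
      Finset.single_le_sum (f := fun m => 1.3 / (H m : ℝ))
        (fun m _ => by have := hHpos m; positivity) (Finset.mem_range.mpr hm)
    have hsubset : ∑ m ∈ Finset.range j, H m * k m ≤ S :=
      Finset.sum_le_sum_of_subset (Finset.range_mono hj)
    -- If every group involved has two heads, each `k m` counts twice in `S`: `2 ∑ k ≤ S < (n + 1) d
    -- ≤ 2 n d`. Rounding then costs nothing.
    by_cases hall : ∀ m < j, 2 ≤ H m
    · have h1 : 2 * ∑ m ∈ Finset.range j, k m ≤ ∑ m ∈ Finset.range j, H m * k m := by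
        rw [Finset.mul_sum]
        exact Finset.sum_le_sum fun m hm =>
          Nat.mul_le_mul_right _ (hall m (Finset.mem_range.mp hm))
      have h2 : ∑ m ∈ Finset.range j, k m ≤ n * d := by nlinarith
      have h3 : ((∑ m ∈ Finset.range j, k m : ℕ) : ℝ) / d ≤ n := by
        rw [div_le_iff₀ hd0]; exact_mod_cast h2
      have := hsingle 0 hj0
      linarith
    -- Rounding down to `n` loses at most one lag; a group with a single head pays for it, as `1.3 /
    -- 1 = 1 + 0.3`.
    · push Not at hall
      obtain ⟨m, hm, hHm⟩ := hall
      have hHm1 : (H m : ℝ) = 1 := by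
        have := hH m
        have : H m = 1 := by omega
        exact_mod_cast this
      have h1 : ∑ m ∈ Finset.range j, k m ≤ ∑ m ∈ Finset.range j, H m * k m :=
        Finset.sum_le_sum fun m _ => Nat.le_mul_of_pos_left _ (hH m)
      have h2 : ∑ m ∈ Finset.range j, k m ≤ (n + 1) * d := by omega
      have h3 : ((∑ m ∈ Finset.range j, k m : ℕ) : ℝ) / d ≤ n + 1 := by
        rw [div_le_iff₀ hd0]; exact_mod_cast h2
      have := hsingle m hm
      rw [hHm1] at this
      linarith
  have hmain := sum_mul_nonneg_of_partial_sums_nonneg c f hf hf0 M hc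
  have hIco : ∑ m ∈ Finset.Ico n M, f m = ∑ m ∈ Finset.range M, (if n ≤ m then 1 else 0) * f m := by
    simp only [ite_mul, one_mul, zero_mul]
    rw [← Finset.sum_filter]
    congr 1
    ext m
    simp only [Finset.mem_filter, Finset.mem_range, Finset.mem_Ico]
    omega
  have hfirst : 0.3 / H 0 * f 0 =
      ∑ m ∈ Finset.range M, (if m = 0 then (0.3 : ℝ) / H 0 else 0) * f m := by
    simp only [ite_mul, zero_mul]
    rw [Finset.sum_ite_eq' (Finset.range M) 0]
    simp [hM]
  simp only [c, sub_mul, Finset.sum_sub_distrib] at hmain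
  rw [hIco, hfirst]
  linarith

/-! ### Transformers that compute convolutions -/

/-- Every linear map is computed by a two-layer ReLU network. -/
theorem FFN.exists_eval_eq_mulVec {D d : ℕ} (A : Matrix (Fin d) (Fin D) ℝ) :
    ∃ F : FFN D d, ∀ z, F.eval z = WithLp.toLp 2 (A.mulVec z) := by
  -- The two halves of the hidden layer realize `y = max y 0 - max (-y) 0`.
  refine ⟨⟨d + d, Matrix.of fun i => Fin.addCases (fun i => A i) (fun i => -A i) i, 0,
    Matrix.of fun a i => Fin.addCases (fun i => (1 : Matrix (Fin d) (Fin d) ℝ) a i)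
      (fun i => -(1 : Matrix (Fin d) (Fin d) ℝ) a i) i, 0⟩, fun z => ?_⟩
  unfold FFN.eval
  congr 1
  ext a
  simp only [Matrix.mulVec, dotProduct, Fin.sum_univ_add, Matrix.of_apply, Fin.addCases_left,
    Fin.addCases_right, add_zero, Pi.add_apply, Pi.zero_apply, Pi.neg_apply, Matrix.one_apply]
  simp only [neg_mul, ite_mul, one_mul, zero_mul, Finset.sum_neg_distrib, Finset.sum_ite_eq,
    Finset.mem_univ, if_true]
  rcases le_total (∑ i, A a i * z i) 0 with h | h
  · rw [max_eq_right h, max_eq_left (by linarith)]; ring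
  · rw [max_eq_left h, max_eq_right (by linarith)]; ring

/-- The head with vanishing query and key matrices and attention weights `(1 - r) r ^ s`. -/
noncomputable def Head.geometric {D k : ℕ} (r : ℝ) (hr0 : 0 < r) (hr1 : r < 1) (W : Matrix (Fin k) (Fin D) ℝ) :
    Head D k where
  WQ := 0
  WK := 0
  WV := W
  slope := -Real.log r
  slope_pos := by have := Real.log_neg hr0 hr1; linarith

/-- The softmax denominator runs over the whole padded past, hence is the full geometric series and
does not depend on `t`. Vanishing of `Z` at negative positions truncates only the numerator. -/
theorem Head.geometric_attn {D k : ℕ} (r : ℝ) (hr0 : 0 < r) (hr1 : r < 1)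
    (W : Matrix (Fin k) (Fin D) ℝ) (Z : ℤ → Fin D → ℝ) (hZ : ∀ u < 0, Z u = 0) (t : ℕ) :
    (Head.geometric r hr0 hr1 W).attn Z t =
      ∑ s ∈ Finset.range (t + 1), ((1 - r) * r ^ s) • W.mulVec (Z ((t : ℤ) - s)) := by
  have hexp (s : ℕ) : Real.exp ((Head.geometric r hr0 hr1 W).logit Z t s) = r ^ s := by
    simp only [Head.logit, Head.geometric, Matrix.zero_mulVec, zero_dotProduct]
    rw [← Real.exp_log (pow_pos hr0 s), Real.log_pow]
    congr 1
    ring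
  have hw (s : ℕ) : (Head.geometric r hr0 hr1 W).weight Z t s = (1 - r) * r ^ s := by
    simp only [Head.weight, hexp]
    rw [tsum_geometric_of_lt_one hr0.le hr1, div_inv_eq_mul, mul_comm]
  unfold Head.attn
  rw [tsum_eq_sum (s := Finset.range (t + 1))]
  · exact Finset.sum_congr rfl fun s _ => by rw [hw]; rfl
  · intro s hs
    have : ¬ s < t + 1 := fun h => hs (Finset.mem_range.mpr h)
    rw [hZ _ (by omega)]
    simp

theorem zeroPad_of_neg {d L : ℕ} (X : Fin L → Vec d) (u : ℤ) (hu : u < 0) : zeroPad X u = 0 := by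
  unfold zeroPad
  rw [dif_neg (by omega)]

theorem convTarget_eq_sum {d L : ℕ} (ρ : ℕ → Matrix (Fin d) (Fin d) ℝ) (X : Fin L → Vec d) (t : ℕ) :
    convTarget ρ X t = ∑ s ∈ Finset.range (t + 1),
      WithLp.toLp 2 ((ρ s).mulVec (zeroPad X ((t : ℤ) - s)).ofLp) := by
  unfold convTarget
  refine tsum_eq_sum fun s hs => ?_
  have : ¬ s < t + 1 := fun h => hs (Finset.mem_range.mpr h)
  rw [zeroPad_of_neg X _ (by omega)]
  simp

/-- For `d ≤ D` there is an isometric embedding of `ℝ^d` into `ℝ^D`. -/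
theorem exists_transpose_mul_eq_one {d D : ℕ} (hdD : d ≤ D) :
    ∃ J : Matrix (Fin D) (Fin d) ℝ, J.transpose * J = 1 := by
  refine ⟨Matrix.of fun a i => if a = Fin.castLE hdD i then 1 else 0, ?_⟩
  ext i i'
  simp only [Matrix.mul_apply, Matrix.transpose_apply, Matrix.of_apply, Matrix.one_apply,
    mul_ite, mul_one, mul_zero, Finset.sum_ite_eq', Finset.mem_univ, if_true]
  simp [Fin.ext_iff, eq_comm]

/-- A Transformer with data-independent geometric heads computes a causal convolution: the matrix
`C` acts on the current token, and the head rates determine the exponential kernel. -/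
theorem Transformer.exists_eval_eq_sum {d D M : ℕ} (hd : 1 ≤ d) {H dh : Fin M → ℕ} (hdD : d ≤ D)
    {n : ℕ} (r : (m : Fin M) × Fin (H m) → ℝ) (hr0 : ∀ h, 0 < r h) (hr1 : ∀ h, r h < 1)
    (C : Matrix (Fin d) (Fin d) ℝ) (hC : IsUnit C.det)
    (e : Fin d → Fin n → (m : Fin M) × Fin (H m) × Fin (dh m))
    (he : ∀ i i' j j', e i j = e i' j' → i = i')
    (g : Fin d → Fin d → Fin n → ℝ) :
    ∃ T : Transformer d D M H dh, ∀ (L : ℕ) (X : Fin L → Vec d) (t : ℕ),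
      T.eval X t = WithLp.toLp 2 (C.mulVec (zeroPad X t).ofLp) + ∑ s ∈ Finset.range (t + 1),
        WithLp.toLp 2 ((Matrix.of fun a i => ∑ j, g a i j * r ⟨(e i j).1, (e i j).2.1⟩ ^ s).mulVec
          (zeroPad X ((t : ℤ) - s)).ofLp) := by
  classical
  have : Nonempty (Fin d) := ⟨⟨0, hd⟩⟩
  -- The token coordinate read by slot `q`. Slots outside the range of `e` read an arbitrary one and
  -- get coefficient zero in `G`.
  let c (q : (m : Fin M) × Fin (H m) × Fin (dh m)) : Fin d :=
    if h : ∃ i j, e i j = q then h.choose else Classical.arbitrary _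
  have hc (i : Fin d) (j : Fin n) : c (e i j) = i := by
    have h : ∃ i' j', e i' j' = e i j := ⟨i, j, rfl⟩
    simp only [c, dif_pos h]
    obtain ⟨j', hj'⟩ := h.choose_spec
    exact he _ _ _ _ hj'
  obtain ⟨J, hJ⟩ := exists_transpose_mul_eq_one hdD
  obtain ⟨F, hF⟩ := FFN.exists_eval_eq_mulVec J.transpose
  -- The factor `(1 - r)⁻¹` cancels the softmax normalization.
  let G : Matrix (Fin d) ((m : Fin M) × Fin (H m) × Fin (dh m)) ℝ := Matrix.of fun a q =>
    ∑ i, ∑ j, if e i j = q then (1 - r ⟨q.1, q.2.1⟩)⁻¹ * g a i j else 0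
  -- The feed forward network sees only the sum of residual and attention, so `C` is placed in the
  -- embedding. The heads undo it by `C⁻¹ * J.transpose`, which is why `C` must be invertible.
  let V (m : Fin M) (h : Fin (H m)) : Matrix (Fin (dh m)) (Fin D) ℝ :=
    (Matrix.of fun k i => if i = c ⟨m, h, k⟩ then (1 : ℝ) else 0) * (C⁻¹ * J.transpose)
  let T : Transformer d D M H dh :=
    { WE := J * C
      bE := 0
      head := fun m h => Head.geometric (r ⟨m, h⟩) (hr0 _) (hr1 _) (V m h)
      WO := J * G
      ffn := F }
  refine ⟨T, fun L X t => ?_⟩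
  have hembed (u : ℤ) : T.embed X u = J.mulVec (C.mulVec (zeroPad X u).ofLp) := by
    simp [Transformer.embed, T, Matrix.mulVec_mulVec]
  have hread (m : Fin M) (h : Fin (H m)) (u : ℤ) (k : Fin (dh m)) :
      (V m h).mulVec (T.embed X u) k = (zeroPad X u).ofLp (c ⟨m, h, k⟩) := by
    rw [hembed, Matrix.mulVec_mulVec, Matrix.mulVec_mulVec, Matrix.mul_assoc]
    have : V m h * (J * C) = Matrix.of fun k i => if i = c ⟨m, h, k⟩ then (1 : ℝ) else 0 := by
      simp only [V]
      rw [Matrix.mul_assoc, Matrix.mul_assoc C⁻¹, ← Matrix.mul_assoc J.transpose, hJ,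
        Matrix.one_mul, Matrix.nonsing_inv_mul C hC, Matrix.mul_one]
    rw [this]
    simp [Matrix.mulVec, dotProduct]
  have hattn (q : (m : Fin M) × Fin (H m) × Fin (dh m)) :
      (T.head q.1 q.2.1).attn (T.embed X) t q.2.2 = ∑ s ∈ Finset.range (t + 1),
        (1 - r ⟨q.1, q.2.1⟩) * r ⟨q.1, q.2.1⟩ ^ s * (zeroPad X ((t : ℤ) - s)).ofLp (c q) := by
    have h0 : ∀ u < 0, T.embed X u = 0 := by
      intro u hu
      rw [hembed, zeroPad_of_neg X u hu]
      simp
    simp only [T]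
    rw [Head.geometric_attn _ _ _ _ _ h0]
    simp only [Finset.sum_apply, Pi.smul_apply, smul_eq_mul]
    exact Finset.sum_congr rfl fun s _ => by rw [hread]
  have heval : T.eval X t = WithLp.toLp 2 (C.mulVec (zeroPad X t).ofLp +
      G.mulVec fun q => (T.head q.1 q.2.1).attn (T.embed X) t q.2.2) := by
    unfold Transformer.eval
    change F.eval _ = _
    rw [hF, Matrix.mulVec_add, hembed, Matrix.mulVec_mulVec, hJ, Matrix.one_mulVec]
    unfold Transformer.mhsa
    change WithLp.toLp 2 (_ + J.transpose.mulVec ((J * G).mulVec _)) = _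
    rw [Matrix.mulVec_mulVec, ← Matrix.mul_assoc, hJ, Matrix.one_mul]
  rw [heval, WithLp.toLp_add]
  congr 1
  rw [← WithLp.toLp_sum]
  congr 1
  ext a
  simp only [hattn, Finset.sum_apply]
  simp only [Matrix.mulVec, dotProduct, Matrix.of_apply, G]
  simp only [Finset.sum_mul]
  calc ∑ q, ∑ i, ∑ j, (if e i j = q then (1 - r ⟨q.1, q.2.1⟩)⁻¹ * g a i j else 0) *
          ∑ s ∈ Finset.range (t + 1), (1 - r ⟨q.1, q.2.1⟩) * r ⟨q.1, q.2.1⟩ ^ s *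
            (zeroPad X ((t : ℤ) - s)).ofLp (c q)
      = ∑ i, ∑ j, ∑ q, (if e i j = q then (1 - r ⟨q.1, q.2.1⟩)⁻¹ * g a i j *
          ∑ s ∈ Finset.range (t + 1), (1 - r ⟨q.1, q.2.1⟩) * r ⟨q.1, q.2.1⟩ ^ s *
            (zeroPad X ((t : ℤ) - s)).ofLp (c q) else 0) := by
        rw [Finset.sum_comm]
        refine Finset.sum_congr rfl fun i _ => ?_
        rw [Finset.sum_comm]
        simp only [ite_mul, zero_mul]
    _ = ∑ i, ∑ j, ∑ s ∈ Finset.range (t + 1), g a i j * r ⟨(e i j).1, (e i j).2.1⟩ ^ s *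
          (zeroPad X ((t : ℤ) - s)).ofLp i := by
        refine Finset.sum_congr rfl fun i _ => Finset.sum_congr rfl fun j _ => ?_
        rw [Finset.sum_ite_eq]
        simp only [Finset.mem_univ, if_true, hc, Finset.mul_sum]
        refine Finset.sum_congr rfl fun s _ => ?_
        have : 1 - r ⟨(e i j).1, (e i j).2.1⟩ ≠ 0 := by
          have := hr1 ⟨(e i j).1, (e i j).2.1⟩
          linarith
        field_simp
    _ = _ := by
        rw [Finset.sum_comm (s := Finset.range (t + 1))]
        exact Finset.sum_congr rfl fun i _ => Finset.sum_comm

/-! ### Error of the approximating Transformer -/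

theorem norm_toLp_mulVec_le {d : ℕ} (A : Matrix (Fin d) (Fin d) ℝ) (x : Vec d) :
    ‖(WithLp.toLp 2 (A.mulVec x.ofLp) : Vec d)‖ ≤ specNorm A * ‖x‖ := by
  have h := (Matrix.toEuclideanCLM (n := Fin d) (𝕜 := ℝ) A).le_opNorm x
  rwa [← WithLp.toLp_ofLp 2 x, Matrix.toEuclideanCLM_toLp] at h

theorem specNorm_nonneg {d : ℕ} (A : Matrix (Fin d) (Fin d) ℝ) : 0 ≤ specNorm A := norm_nonneg _

theorem specNorm_eq_zero {d : ℕ} {A : Matrix (Fin d) (Fin d) ℝ} (h : specNorm A = 0) : A = 0 :=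
  (map_eq_zero_iff _ (Matrix.toEuclideanCLM (n := Fin d) (𝕜 := ℝ)).injective).mp
    (norm_eq_zero.mp h)

theorem norm_toLp_mulVec_le_of_entries {d : ℕ} (A : Matrix (Fin d) (Fin d) ℝ) {η : ℝ}
    (hA : ∀ a i, |A a i| ≤ η) (x : Vec d) :
    ‖(WithLp.toLp 2 (A.mulVec x.ofLp) : Vec d)‖ ≤ d * d * η * ‖x‖ := by
  have h1 (v : Vec d) : ‖v‖ ≤ ∑ a, |v.ofLp a| := by
    rw [EuclideanSpace.norm_eq]
    refine Real.sqrt_le_iff.mpr ⟨Finset.sum_nonneg fun _ _ => abs_nonneg _, ?_⟩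
    simpa only [Real.norm_eq_abs] using
      Finset.sum_sq_le_sq_sum_of_nonneg (s := Finset.univ) (f := fun a => |v.ofLp a|)
        fun a _ => abs_nonneg _
  refine (h1 _).trans ?_
  have h2 (a : Fin d) : |A.mulVec x.ofLp a| ≤ d * η * ‖x‖ := by
    simp only [Matrix.mulVec, dotProduct]
    refine (Finset.abs_sum_le_sum_abs (fun i => A a i * x.ofLp i) Finset.univ).trans ?_
    calc ∑ i, |A a i * x.ofLp i| ≤ ∑ _i : Fin d, η * ‖x‖ := by
          refine Finset.sum_le_sum fun i _ => ?_
          rw [abs_mul]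
          exact mul_le_mul (hA a i) (PiLp.norm_apply_le x i) (abs_nonneg _)
            ((abs_nonneg _).trans (hA a i))
      _ = d * η * ‖x‖ := by simp [mul_assoc]
  refine (Finset.sum_le_sum fun a _ => h2 a).trans (le_of_eq ?_)
  simp [mul_assoc]

theorem norm_zeroPad_le {d L : ℕ} {X : Fin L → Vec d} {B : ℝ} (hB0 : 0 ≤ B)
    (hB : ∀ t, ‖X t‖ ≤ B) (u : ℤ) : ‖zeroPad X u‖ ≤ B := by
  unfold zeroPad
  split_ifs
  · exact hB _
  · simpa using hB0

/-- A linear map acting on the current token alone is computed exactly. -/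
theorem Transformer.exists_eval_eq_mulVec {d D M : ℕ} {H dh : Fin M → ℕ} (hdD : d ≤ D)
    (C : Matrix (Fin d) (Fin d) ℝ) :
    ∃ T : Transformer d D M H dh, ∀ (L : ℕ) (X : Fin L → Vec d) (t : ℤ),
      T.eval X t = WithLp.toLp 2 (C.mulVec (zeroPad X t).ofLp) := by
  obtain ⟨J, hJ⟩ := exists_transpose_mul_eq_one hdD
  obtain ⟨F, hF⟩ := FFN.exists_eval_eq_mulVec (C * J.transpose)
  refine ⟨{ WE := J, bE := 0, WO := 0, ffn := F,
            head := fun m h => Head.geometric (1 / 2) (by norm_num) (by norm_num) 0 },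
    fun L X t => ?_⟩
  simp only [Transformer.eval, Transformer.mhsa, Transformer.embed, Matrix.zero_mulVec, add_zero]
  rw [hF, Matrix.mulVec_mulVec, Matrix.mul_assoc, hJ, Matrix.mul_one]

/-- Approximation of a convolution by heads of total rank at least `n * d`: the lags up to `n` are
matched up to an arbitrarily small error. -/
theorem Transformer.exists_norm_sub_le {d D M L : ℕ} (hd : 1 ≤ d) {H dh : Fin M → ℕ} (hdD : d ≤ D)
    (n : ℕ) (hn : n * d ≤ ∑ m, H m * min (dh m) d) (ρ : ℕ → Matrix (Fin d) (Fin d) ℝ)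
    {η : ℝ} (hη : 0 < η) :
    ∃ T : Transformer d D M H dh, ∀ (X : Fin L → Vec d) (B : ℝ), 0 ≤ B → (∀ t, ‖X t‖ ≤ B) →
      ∀ t < L, ‖convTarget ρ X t - T.eval X t‖ ≤
        (∑ s ∈ Finset.Ico n L, specNorm (ρ (s + 1))) * B + η * B := by
  classical
  let ι := (m : Fin M) × Fin (H m)
  let φ := Fintype.equivFin ι
  obtain ⟨e₀, he₀, he₀'⟩ := exists_balanced_slots (ι := ι) (fun h => min (dh h.1) d) d n
    (fun h => min_le_right _ _) (by rw [Fintype.sum_sigma]; simpa using hn)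
  let inc (q : (h : ι) × Fin (min (dh h.1) d)) : (m : Fin M) × Fin (H m) × Fin (dh m) :=
    ⟨q.1.1, q.1.2, Fin.castLE (min_le_left _ _) q.2⟩
  have hinc : Function.Injective inc := by
    rintro ⟨⟨m, h⟩, k⟩ ⟨⟨m', h'⟩, k'⟩ heq
    obtain ⟨h1, h2⟩ := Sigma.mk.inj heq
    obtain rfl : m = m' := h1
    have h3 := Prod.mk.inj (eq_of_heq h2)
    obtain rfl : h = h' := h3.1
    have : k = k' := by simpa [Fin.ext_iff] using h3.2
    rw [this]
  let e (i : Fin d) (j : Fin n) := inc (e₀ i j)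
  have he (i i' : Fin d) (j j' : Fin n) (h : e i j = e i' j') : i = i' :=
    he₀' i i' j j' (hinc h)
  -- One node per head: all slots of a head share its rate `τ * a h`. The slots of one coordinate
  -- lie in distinct heads, so their nodes are distinct.
  let a (h : ι) : ℝ := (φ h : ℕ) + 1
  have ha0 (h : ι) : 0 < a h := by positivity
  have ha : Function.Injective a := by
    intro h h' heq
    have h1 : ((φ h : ℕ) : ℝ) = (φ h' : ℕ) := add_right_cancel heq
    exact φ.injective (Fin.ext (by exact_mod_cast h1))
  -- Fewer than `L` lags occur, and passing from entries to the operator norm costs `d * d`;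
  -- together the lags spend at most `η / 2`.
  let η₁ : ℝ := η / (2 * (L * (d * d) + 1))
  have hη₁ : 0 < η₁ := by positivity
  have hsmall : ∀ᶠ τ in nhdsWithin (0 : ℝ) (Set.Ioi 0), ∀ h : ι, τ * a h < 1 := by
    rw [Filter.eventually_all]
    intro h
    have hcont : Continuous fun τ : ℝ => τ * a h := by fun_prop
    exact nhdsWithin_le_nhds (hcont.continuousAt.eventually_lt (continuousAt_const (y := 1))
      (by simp))
  have hexp : ∀ᶠ τ in nhdsWithin (0 : ℝ) (Set.Ioi 0), ∀ b i : Fin d, ∃ g : Fin n → ℝ,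
      (∀ s < n, ∑ j, g j * (τ * a (e₀ i j).1) ^ (s + 1) = ρ (s + 1) b i) ∧
      ∀ s < L, n ≤ s → |∑ j, g j * (τ * a (e₀ i j).1) ^ (s + 1)| ≤ η₁ := by
    rw [Filter.eventually_all]
    intro b
    rw [Filter.eventually_all]
    intro i
    exact eventually_exists_exponential_sum (fun j => a (e₀ i j).1) (ha.comp (he₀ i))
      (fun j => (ha0 _).ne') (fun s => ρ (s + 1) b i) L η₁ hη₁
  obtain ⟨τ, ⟨hτ1, hτ2⟩, hτ0⟩ := ((hsmall.and hexp).and self_mem_nhdsWithin).exists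
  choose g hg1 hg2 using hτ2
  let K (s : ℕ) : Matrix (Fin d) (Fin d) ℝ :=
    Matrix.of fun b i => ∑ j, g b i j * (τ * a (e₀ i j).1) ^ s
  -- The heads already contribute `K 0` at lag `0`, so the residual must supply `ρ 0 - K 0`. Making
  -- this invertible spends the other `η / 2`.
  obtain ⟨ε, hε0, hε, hunit⟩ := exists_small_isUnit_add_smul_one (ρ 0 - K 0) (half_pos hη)
  obtain ⟨T, hT⟩ := Transformer.exists_eval_eq_sum (H := H) (dh := dh) hd hdD
    (fun h : ι => τ * a h) (fun h => mul_pos hτ0 (ha0 h)) hτ1 _ hunit e he g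
  refine ⟨T, fun X B hB0 hB t ht => ?_⟩
  have hx (s : ℕ) : ‖zeroPad X ((t : ℤ) - s)‖ ≤ B := norm_zeroPad_le hB0 hB _
  have hdiff : convTarget ρ X t - T.eval X t = -(ε • zeroPad X t) +
      ∑ s ∈ Finset.range t, WithLp.toLp 2
        ((ρ (s + 1) - K (s + 1)).mulVec (zeroPad X ((t : ℤ) - (s + 1 : ℕ))).ofLp) := by
    rw [convTarget_eq_sum, hT L X t]
    change _ - (_ + ∑ s ∈ Finset.range (t + 1),
      WithLp.toLp 2 ((K s).mulVec (zeroPad X ((t : ℤ) - s)).ofLp)) = _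
    rw [Finset.sum_range_succ', Finset.sum_range_succ']
    simp only [Matrix.sub_mulVec, Matrix.add_mulVec, WithLp.toLp_sub, WithLp.toLp_add,
      Finset.sum_sub_distrib, Matrix.smul_mulVec, Matrix.one_mulVec, WithLp.toLp_smul,
      WithLp.toLp_ofLp, Nat.cast_zero, sub_zero]
    abel
  have hterm (s : ℕ) (hs : s < L) : ‖(WithLp.toLp 2 ((ρ (s + 1) - K (s + 1)).mulVec
      (zeroPad X ((t : ℤ) - (s + 1 : ℕ))).ofLp) : Vec d)‖ ≤
      (if n ≤ s then specNorm (ρ (s + 1)) * B else 0) + d * d * η₁ * B := by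
    split_ifs with hns
    · rw [Matrix.sub_mulVec, WithLp.toLp_sub]
      refine (norm_sub_le _ _).trans (add_le_add ?_ ?_)
      · exact (norm_toLp_mulVec_le _ _).trans
          (mul_le_mul_of_nonneg_left (hx _) (specNorm_nonneg _))
      · exact (norm_toLp_mulVec_le_of_entries _ (fun b i => hg2 b i s hs hns) _).trans
          (mul_le_mul_of_nonneg_left (hx _) (by positivity))
    · have : ρ (s + 1) - K (s + 1) = 0 := by
        ext b i
        simp only [K, Matrix.sub_apply, Matrix.of_apply, Matrix.zero_apply]
        rw [hg1 b i s (by omega), sub_self]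
      rw [this]
      simp only [Matrix.zero_mulVec, WithLp.toLp_zero, norm_zero]
      positivity
  have hIco : ∑ s ∈ Finset.range t, (if n ≤ s then specNorm (ρ (s + 1)) * B else 0) ≤
      (∑ s ∈ Finset.Ico n L, specNorm (ρ (s + 1))) * B := by
    rw [← Finset.sum_filter, Finset.sum_mul]
    refine Finset.sum_le_sum_of_subset_of_nonneg ?_ fun s _ _ =>
      mul_nonneg (specNorm_nonneg _) hB0
    intro s
    simp only [Finset.mem_filter, Finset.mem_range, Finset.mem_Ico]
    omega
  have hrest : (t : ℝ) * (d * d * η₁ * B) ≤ η / 2 * B := by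
    have h1 : (t : ℝ) ≤ L := by exact_mod_cast ht.le
    have h2 : (L : ℝ) * (d * d) * η₁ ≤ η / 2 := by
      simp only [η₁]
      rw [mul_div_assoc', div_le_iff₀ (by positivity)]
      nlinarith
    calc (t : ℝ) * (d * d * η₁ * B) ≤ L * (d * d * η₁ * B) := by gcongr
      _ = L * (d * d) * η₁ * B := by ring
      _ ≤ η / 2 * B := by gcongr
  rw [hdiff]
  calc _ ≤ ε * B + ∑ s ∈ Finset.range t,
          ((if n ≤ s then specNorm (ρ (s + 1)) * B else 0) + d * d * η₁ * B) := by
        refine (norm_add_le _ _).trans (add_le_add ?_ ?_)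
        · rw [norm_neg, norm_smul, Real.norm_of_nonneg hε0.le]
          exact mul_le_mul_of_nonneg_left (norm_zeroPad_le hB0 hB _) hε0.le
        · refine (norm_sum_le _ _).trans (Finset.sum_le_sum fun s hs => hterm s ?_)
          exact (Finset.mem_range.mp hs).trans ht
    _ ≤ η / 2 * B + ((∑ s ∈ Finset.Ico n L, specNorm (ρ (s + 1))) * B + η / 2 * B) := by
        rw [Finset.sum_add_distrib, Finset.sum_const, Finset.card_range, nsmul_eq_mul]
        gcongr
    _ = _ := by ring

/-! ### Comparison with the stated bound -/

theorem epsDelta_nonneg (M L : ℕ) (dh : Fin M → ℕ) (δ : ℝ) : 0 ≤ epsDelta M L dh δ :=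
  Real.sqrt_nonneg _

/-- The weight of a group in the bound dominates the missing rank fraction plus `1.3 / H`. -/
theorem one_sub_div_add_le_weight {d k H m : ℕ} (hd : 1 ≤ d) {ε : ℝ} (hε : 0 ≤ ε) :
    1 - ((min k d : ℕ) : ℝ) / d + 1.3 / H ≤
      (1 + ε) * (if k ≤ d then Real.sqrt (1 - (k : ℝ) / d) else 0)
        + 1.3 * Real.exp (0.02 * ((m : ℝ) + 1)) / H := by
  have hd0 : (0 : ℝ) < d := by exact_mod_cast hd
  refine add_le_add ?_ ?_
  · split_ifs with h
    · rw [min_eq_left h]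
      have h1 : (k : ℝ) / d ≤ 1 := by rw [div_le_one hd0]; exact_mod_cast h
      have h0 : (0 : ℝ) ≤ k / d := by positivity
      -- On `[0, 1]`, `y ^ 2 ≤ y` gives `y ≤ √y`.
      have h2 : 1 - (k : ℝ) / d ≤ Real.sqrt (1 - (k : ℝ) / d) :=
        Real.le_sqrt_of_sq_le (by nlinarith)
      nlinarith [Real.sqrt_nonneg (1 - (k : ℝ) / d)]
    · rw [min_eq_right (by omega), div_self hd0.ne']
      simp
  · have : (1 : ℝ) ≤ Real.exp (0.02 * ((m : ℝ) + 1)) := Real.one_le_exp (by positivity)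
    gcongr
    linarith

/-- Room for the lags which heads of total rank `∑ H_m min(d_m, d)` do not cover. -/
theorem sum_uncovered_add_le_tradeoffBound {d M L : ℕ} (hd : 1 ≤ d) (H dh : Fin M → ℕ)
    (hH : ∀ m, 1 ≤ H m) (hS : d ≤ ∑ m, H m * min (dh m) d) (ρ : ℕ → Matrix (Fin d) (Fin d) ℝ)
    (hρ : ∀ i j : ℕ, 1 ≤ i → i ≤ j → specNorm (ρ j) ≤ specNorm (ρ i)) (B : ℝ) (hB : 0 ≤ B)
    (δ : ℝ) : ∃ θ : ℝ, 0 < θ ∧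
      (∑ s ∈ Finset.Ico ((∑ m, H m * min (dh m) d) / d) L, specNorm (ρ (s + 1))) * B +
        θ * specNorm (ρ 1) * B ≤ tradeoffBound M L H dh ρ B δ := by
  -- Beyond the `M` groups the data are extended by one head of dimension `d`, which keeps the
  -- hypotheses valid for all `m`; the sums over groups stop at `M`.
  let H' (m : ℕ) : ℕ := if h : m < M then H ⟨m, h⟩ else 1
  let k' (m : ℕ) : ℕ := min (if h : m < M then dh ⟨m, h⟩ else d) d
  let w (m h k : ℕ) : ℝ := (1 + epsDelta M L dh δ) *
    (if k ≤ d then Real.sqrt (1 - (k : ℝ) / d) else 0)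
      + 1.3 * Real.exp (0.02 * ((m : ℝ) + 1)) / h
  let b (m : ℕ) : ℝ := w m (H' m) (if h : m < M then dh ⟨m, h⟩ else d)
  have hH' (m : ℕ) : 1 ≤ H' m := by
    simp only [H']; split_ifs
    · exact hH _
    · exact le_rfl
  have hsum : ∑ m ∈ Finset.range M, H' m * k' m = ∑ m, H m * min (dh m) d := by
    rw [← Fin.sum_univ_eq_sum_range (fun m => H' m * k' m)]
    simp [H', k']
  have hmain := sum_tail_le_sum_weights H' k' b (fun m => specNorm (ρ (m + 1))) d M hd hH'
    (hsum ▸ hS) (fun m => one_sub_div_add_le_weight hd (epsDelta_nonneg M L dh δ))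
    (fun m => min_le_right _ _) (fun i j hij => hρ _ _ (by omega) (by omega))
    (fun m => specNorm_nonneg _)
  rw [hsum] at hmain
  set n := (∑ m, H m * min (dh m) d) / d
  have hpos : (0 : ℝ) < 0.3 / H' 0 := by
    have : (0 : ℝ) < H' 0 := by exact_mod_cast hH' 0
    positivity
  refine ⟨_, hpos, ?_⟩
  have hsplit : ∑ s ∈ Finset.Ico n L, specNorm (ρ (s + 1)) ≤
      ∑ s ∈ Finset.Ico n M, specNorm (ρ (s + 1)) + ∑ s ∈ Finset.Icc (M + 1) L, specNorm (ρ s) := by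
    have h1 : ∑ s ∈ Finset.Icc (M + 1) L, specNorm (ρ s) =
        ∑ s ∈ Finset.Ico M L, specNorm (ρ (s + 1)) := by
      rw [Finset.sum_Ico_add' (fun s => specNorm (ρ s)) M L 1]
      rfl
    rw [h1, ← Finset.sum_union (Finset.disjoint_left.mpr fun s hs hs' => by
      simp only [Finset.mem_Ico] at hs hs'; omega)]
    refine Finset.sum_le_sum_of_subset_of_nonneg ?_ fun s _ _ => specNorm_nonneg _
    intro s
    simp only [Finset.mem_union, Finset.mem_Ico]
    omega
  have hweights : ∑ m : Fin M, specNorm (ρ ((m : ℕ) + 1)) * B * w m (H m) (dh m) =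
      (∑ m ∈ Finset.range M, b m * specNorm (ρ (m + 1))) * B := by
    rw [← Fin.sum_univ_eq_sum_range (fun m => b m * specNorm (ρ (m + 1))), Finset.sum_mul]
    refine Finset.sum_congr rfl fun m _ => ?_
    simp only [b, H', m.2, dif_pos, Fin.eta]
    ring
  have hdef : tradeoffBound M L H dh ρ B δ =
      ∑ m : Fin M, specNorm (ρ ((m : ℕ) + 1)) * B * w m (H m) (dh m) +
        ∑ k ∈ Finset.Icc (M + 1) L, specNorm (ρ k) * B := rfl
  rw [hdef, hweights, ← Finset.sum_mul, ← add_mul, ← add_mul]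
  refine mul_le_mul_of_nonneg_right ?_ hB
  simp only [zero_add] at hmain
  linarith

theorem seqError_nonneg {d D M L : ℕ} {H dh : Fin M → ℕ} (ρ : ℕ → Matrix (Fin d) (Fin d) ℝ)
    (T : Transformer d D M H dh) (X : Fin L → Vec d) : 0 ≤ seqError ρ T X :=
  Real.iSup_nonneg fun _ => norm_nonneg _

/-- One Transformer attains the bound on all sequences of tokens of norm at most `B`. -/
theorem Transformer.exists_seqError_le {d D M L : ℕ} (hd : 1 ≤ d) (hL : 1 ≤ L) (H dh : Fin M → ℕ)
    (hH : ∀ m, 1 ≤ H m) (hD : D = ∑ m, H m * dh m) (hdD : d ≤ D)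
    (ρ : ℕ → Matrix (Fin d) (Fin d) ℝ)
    (hρ : ∀ i j : ℕ, 1 ≤ i → i ≤ j → specNorm (ρ j) ≤ specNorm (ρ i)) (B : ℝ) (hB : 0 < B)
    (δ : ℝ) : ∃ T : Transformer d D M H dh, ∀ X : Fin L → Vec d, (∀ t, ‖X t‖ ≤ B) →
      seqError ρ T X ≤ tradeoffBound M L H dh ρ B δ := by
  have : Nonempty (Fin L) := ⟨⟨0, hL⟩⟩
  -- A single head of dimension at least `d` suffices; otherwise no dimension is capped and the sum
  -- is `D`.
  have hS : d ≤ ∑ m, H m * min (dh m) d := by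
    by_cases h : ∃ m, d ≤ dh m
    · obtain ⟨m, hm⟩ := h
      refine le_trans ?_ (Finset.single_le_sum (f := fun m => H m * min (dh m) d)
        (fun _ _ => Nat.zero_le _) (Finset.mem_univ m))
      rw [min_eq_right hm]
      exact Nat.le_mul_of_pos_left _ (hH m)
    · push Not at h
      refine hdD.trans (hD.trans_le (Finset.sum_le_sum fun m _ => ?_))
      rw [min_eq_left (h m).le]
  obtain ⟨θ, hθ, hbound⟩ := sum_uncovered_add_le_tradeoffBound (L := L) hd H dh hH hS ρ hρ B hB.le δ
  -- The slack `θ * specNorm (ρ 1)` serves as the small error `η`. If it vanishes, monotonicity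
  -- kills every lag after `0`, and the target is computed exactly.
  rcases (specNorm_nonneg (ρ 1)).eq_or_lt with h1 | h1
  · have hzero (s : ℕ) : ρ (s + 1) = 0 :=
      specNorm_eq_zero (le_antisymm ((hρ 1 (s + 1) le_rfl (by omega)).trans h1.ge)
        (specNorm_nonneg _))
    obtain ⟨T, hT⟩ := Transformer.exists_eval_eq_mulVec (H := H) (dh := dh) hdD (ρ 0)
    refine ⟨T, fun X _ => ciSup_le fun t => le_trans (b := 0) (le_of_eq ?_) (le_trans ?_ hbound)⟩
    · rw [hT, convTarget_eq_sum, Finset.sum_range_succ', Finset.sum_eq_zero]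
      · simp
      · intro s _
        rw [hzero]
        simp
    · rw [← h1, mul_zero, zero_mul, add_zero]
      exact mul_nonneg (Finset.sum_nonneg fun s _ => specNorm_nonneg _) hB.le
  · obtain ⟨T, hT⟩ := Transformer.exists_norm_sub_le (H := H) (dh := dh) (L := L) hd hdD _
      (Nat.div_mul_le_self _ d) ρ (mul_pos hθ h1)
    refine ⟨T, fun X hX => ciSup_le fun t => ?_⟩
    exact (hT X B hB.le hX t t.2).trans hbound

/-! ### Passage to random sequences -/

theorem theorem1 {Ω : Type*} [MeasurableSpace Ω] (μ : Measure Ω) [IsProbabilityMeasure μ]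
    (d L D M : ℕ) (hd : 1 ≤ d) (hL : 1 ≤ L)
    (H dh : Fin M → ℕ) (hH : ∀ m, 1 ≤ H m) (hdh : ∀ m, 1 ≤ dh m)
    (hD : D = ∑ m, H m * dh m) (hdD : d ≤ D)
    (ρ : ℕ → Matrix (Fin d) (Fin d) ℝ)
    (hρ : ∀ i j : ℕ, 1 ≤ i → i ≤ j → specNorm (ρ j) ≤ specNorm (ρ i))
    (B : ℝ) (X : Fin L → Ω → Vec d)
    (hX : ∀ t, AEMeasurable (X t) μ)
    (hB : ∀ t, ∀ᵐ ω ∂μ, ‖X t ω‖ ≤ B)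
    (hmean : ∀ t, ∫ ω, X t ω ∂μ = 0)
    (hcov : ∀ t i j, ∫ ω, X t ω i * X t ω j ∂μ = if i = j then 1 else 0)
    (δ : ℝ) (hδ0 : 0 < δ) (hδ1 : δ < 1) :
    (∃ T : Transformer d D M H dh, ENNReal.ofReal (1 - δ) ≤
      μ {ω | seqError ρ T (fun t => X t ω) ≤ tradeoffBound M L H dh ρ B δ}) ∧
    ENNReal.ofReal (1 - δ) ≤
      μ {ω | approxError D M H dh ρ (fun t => X t ω) ≤ tradeoffBound M L H dh ρ B δ} := by
  -- A token with unit second moments cannot vanish almost surely.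
  have hBpos : 0 < B := by
    by_contra hneg
    have h0 : ∀ᵐ ω ∂μ, X ⟨0, hL⟩ ω ⟨0, hd⟩ * X ⟨0, hL⟩ ω ⟨0, hd⟩ = 0 := by
      filter_upwards [hB ⟨0, hL⟩] with ω hω
      have : X ⟨0, hL⟩ ω = 0 := norm_le_zero_iff.mp (hω.trans (not_lt.mp hneg))
      simp [this]
    have h1 := hcov ⟨0, hL⟩ ⟨0, hd⟩ ⟨0, hd⟩
    rw [integral_congr_ae h0] at h1
    simp at h1
  obtain ⟨T, hT⟩ := Transformer.exists_seqError_le hd hL H dh hH hD hdD ρ hρ B hBpos δ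
  have hall : ∀ᵐ ω ∂μ, ∀ t, ‖X t ω‖ ≤ B := ae_all_iff.mpr hB
  have hprob (p : Ω → Prop) (hp : ∀ᵐ ω ∂μ, p ω) : ENNReal.ofReal (1 - δ) ≤ μ {ω | p ω} := by
    rw [measure_congr (Filter.eventuallyEq_univ.mpr hp), measure_univ]
    exact ENNReal.ofReal_le_one.mpr (by linarith)
  refine ⟨⟨T, hprob _ ?_⟩, hprob _ ?_⟩
  · filter_upwards [hall] with ω hω using hT _ hω
  · filter_upwards [hall] with ω hω
    refine (ciInf_le ⟨0, ?_⟩ T).trans (hT _ hω)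
    rintro _ ⟨T', rfl⟩
    exact seqError_nonneg ρ T' _
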